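/- Let $\mathbb{D}$ be the open unit disc in $\mathbb{C}$, let $\mathbb{T}=\partial\mathbb{D}$, and let $H^\infty(\mathbb{D})$ be the algebra of bounded holomorphic functions $f:\mathbb{D}\to\mathbb{C}$. Subalgebras are not required to contain the constant function $1$. A subset $C$ of a commutative algebra $\mathcal{A}$ is called strongly $\kappa$-algebrable, for an infinite cardinal $\kappa$, if $C\cup\{0\}$ contains a subalgebra of $\mathcal{A}$ generated by an algebraically independent set of cardinality $\kappa$. Let $\mathfrak{c}$ denote the cardinality of the continuum. Theorem. Let $E\subset\mathbb{T}$ be a set of (arc length) measure zero. Then there is a subalgebra of $H^\infty(\mathbb{D})$, of dimension $\mathfrak{c}$ as a complex vector space, such that for every nonzero element $f$ of it the limit $\lim_{r\to 1^-}f(rw)$ fails to exist for every $w\in E$. Moreover, the set of all $f\in H^\infty(\mathbb{D})$ such that $\lim_{r\to 1^-}f(rw)$ fails to exist for every $w\in E$ is strongly $\mathfrak{c}$-algebrable. -/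

import Mathlib

open Filter Topology Cardinal MeasureTheory
open scoped Complex.UnitDisc

/-- The extension by zero to `ℂ` of a function on the open unit disc. Only its values on the open
unit disc, where it agrees with `f`, are ever used. -/
noncomputable def discExtend (f : 𝔻 → ℂ) : ℂ → ℂ :=
  Function.extend ((↑) : 𝔻 → ℂ) f 0

theorem discExtend_coe (f : 𝔻 → ℂ) (z : 𝔻) : discExtend f (z : ℂ) = f z :=
  Complex.UnitDisc.coe_injective.extend_apply f 0 z

theorem discExtend_of_norm_lt (f : 𝔻 → ℂ) {z : ℂ} (hz : ‖z‖ < 1) :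
    discExtend f z = f (Complex.UnitDisc.mk z hz) :=
  discExtend_coe f (Complex.UnitDisc.mk z hz)

/-- A function on the open unit disc is holomorphic. -/
def IsHolomorphicOnDisc (f : 𝔻 → ℂ) : Prop :=
  DifferentiableOn ℂ (discExtend f) (Metric.ball (0 : ℂ) 1)

theorem isHolomorphicOnDisc_of_eq {f : 𝔻 → ℂ} {F : ℂ → ℂ}
    (hF : DifferentiableOn ℂ F (Metric.ball (0 : ℂ) 1)) (h : ∀ z : 𝔻, f z = F z) :
    IsHolomorphicOnDisc f :=
  hF.congr fun z hz => by
    rw [discExtend_of_norm_lt f (mem_ball_zero_iff.1 hz), h, Complex.UnitDisc.coe_mk]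

/-- `H^∞(𝔻)`: the algebra, under pointwise operations, of bounded holomorphic functions on the open
unit disc. -/
noncomputable def HInfty : Subalgebra ℂ (𝔻 → ℂ) where
  carrier := {f | IsHolomorphicOnDisc f ∧ ∃ C : ℝ, ∀ z, ‖f z‖ ≤ C}
  mul_mem' := by
    rintro f g ⟨hf, C, hC⟩ ⟨hg, D, hD⟩
    refine ⟨isHolomorphicOnDisc_of_eq (hf.mul hg) fun z => ?_, C * D, fun z => ?_⟩
    · simp [discExtend_coe]
    · rw [Pi.mul_apply, norm_mul]
      exact mul_le_mul (hC z) (hD z) (norm_nonneg _) ((norm_nonneg _).trans (hC z))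
  add_mem' := by
    rintro f g ⟨hf, C, hC⟩ ⟨hg, D, hD⟩
    refine ⟨isHolomorphicOnDisc_of_eq (hf.add hg) fun z => ?_, C + D, fun z => ?_⟩
    · simp [discExtend_coe]
    · exact (norm_add_le _ _).trans (add_le_add (hC z) (hD z))
  algebraMap_mem' c :=
    ⟨isHolomorphicOnDisc_of_eq (differentiableOn_const c) fun _ => rfl, ‖c‖, fun _ => le_rfl⟩

/-- `f` has a radial limit at the point `w` of the unit circle:
`lim_{r → 1⁻} f (r w)` exists in `ℂ`. -/
def HasRadialLimitAt (f : 𝔻 → ℂ) (w : Circle) : Prop :=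
  ∃ l : ℂ, Tendsto (fun r : ℝ => discExtend f ((r : ℂ) * (w : ℂ))) (𝓝[<] 1) (𝓝 l)

/-- The Lusin-type functions for `E`: the bounded holomorphic functions on the disc that fail to
have a radial limit at every point of `E`. -/
def lusinSet (E : Set Circle) : Set HInfty :=
  {f | ∀ w ∈ E, ¬ HasRadialLimitAt (f : 𝔻 → ℂ) w}

/-- The arc length (Lebesgue outer measure) of a subset of the unit circle. -/
noncomputable def arcLength (E : Set Circle) : ENNReal :=
  volume {θ : ℝ | θ ∈ Set.Ico 0 (2 * Real.pi) ∧ Circle.exp θ ∈ E}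

/-- A subset `C` of a commutative algebra `A` is strongly `κ`-algebrable if `C ∪ {0}` contains a
subalgebra of `A` generated by an algebraically independent set of cardinality `κ`. Subalgebras
are not required to contain the unit of `A`: the generated subalgebra consists of the values at
the generators of the polynomials without constant term. -/
def IsStronglyAlgebrable (𝕜 : Type*) {A : Type*} [Field 𝕜] [CommRing A] [Algebra 𝕜 A]
    (κ : Cardinal) (C : Set A) : Prop :=
  ∃ G : Set A, #G = κ ∧ AlgebraicIndependent 𝕜 ((↑) : G → A) ∧
    (NonUnitalAlgebra.adjoin 𝕜 G : Set A) ⊆ C ∪ {0}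

/-! A null set of angles can be covered infinitely often by intervals of finite total length. One
kernel of positive real part per interval, summed, gives a holomorphic `g` on the disc with `Re g >
0` and `Re g → ∞` along every radius ending in `E`. Then `F = g ^ i` has modulus `exp (-arg g)`,
between two positive constants, and argument `log |g| → ∞`, so it winds around 0 forever along these
radii.

This single `F` yields the whole algebra: its generators are `exp (a F)`, with `a` in a Hamel basis
of `ℂ` over `ℚ`. A polynomial in them is `φ ∘ F` with `φ` an entire exponential sum, constant only
if the polynomial is. If `φ ∘ F` had the radial limit `l`, the bounded path of `F` could accumulate
only in the discrete set `φ⁻¹(l)`, so by connectedness it would converge. The key steps are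
`exists_re_tendsto_atTop`, `exists_tendsto_of_tendsto_comp` and `eq_C_of_aeval_exp_eq`. -/

/-! ### Null sets and positive real parts that blow up radially -/

/-- A null set of reals has a cover by intervals of finite total length that covers each of its
points infinitely often. -/
theorem exists_summable_infinite_cover {S : Set ℝ} (hS : volume S = 0) :
    ∃ (ι : Type) (c δ : ι → ℝ), (∀ i, 0 < δ i) ∧ Summable δ ∧
      ∀ θ ∈ S, {i | |θ - c i| ≤ δ i}.Infinite := by
  have key (n : ℕ) := Besicovitch.exists_closedBall_covering_tsum_measure_le volume
    (ε := (2⁻¹ : ENNReal) ^ n) (by simp) (fun _ => Set.Ioi 0) S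
    (fun _ _ δ hδ => ⟨δ / 2, by simp [hδ]⟩)
  choose t r _ _ hr hcover hsum using key
  refine ⟨Σ n, t n, fun i => i.2, fun i => r i.1 i.2, fun i => hr i.1 _ i.2.2, ?_, ?_⟩
  · have hfin : ∑' i : Σ n, t n, ENNReal.ofReal (2 * r i.1 i.2) ≠ ⊤ := by
      rw [ENNReal.tsum_sigma' (fun i : Σ n, t n => ENNReal.ofReal (2 * r i.1 i.2))]
      refine ne_top_of_le_ne_top ?_ (ENNReal.tsum_le_tsum fun n => ?_)
        (b := ∑' n : ℕ, (2⁻¹ : ENNReal) ^ n)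
      · rw [ENNReal.tsum_geometric]
        simp
      · simpa [hS, Real.volume_closedBall] using hsum n
    have h := (ENNReal.summable_toReal hfin).mul_left (2⁻¹ : ℝ)
    refine h.congr fun i => ?_
    rw [ENNReal.toReal_ofReal (by linarith [Set.mem_Ioi.1 (hr i.1 _ i.2.2)])]
    ring
  -- Each level `n` is itself a cover, so the intervals containing `θ` involve every `n`.
  · intro θ hθ hfin
    refine Set.infinite_univ (α := ℕ) ((hfin.image Sigma.fst).subset fun n _ => ?_)
    obtain ⟨x, hx, hθx⟩ := Set.mem_iUnion₂.1 (hcover n hθ)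
    exact ⟨⟨n, x, hx⟩, by simpa [Real.dist_eq] using hθx, rfl⟩

theorem norm_exp_mul_I_sub_le (a b : ℝ) :
    ‖Complex.exp (a * Complex.I) - Complex.exp (b * Complex.I)‖ ≤ |a - b| := by
  have h : Complex.exp (a * Complex.I) - Complex.exp (b * Complex.I) =
      Complex.exp (b * Complex.I) * (Complex.exp (Complex.I * (a - b : ℝ)) - 1) := by
    rw [mul_sub, ← Complex.exp_add, mul_one]
    congr 2
    push_cast
    ring
  rw [h, norm_mul, Complex.norm_exp_ofReal_mul_I, one_mul]
  exact Real.norm_exp_I_mul_ofReal_sub_one_le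

/-- A holomorphic function of positive real part on the disc, whose real part is at least `1 / 9`
on the part of the disc within `δ` of the point `exp (i c)` in angle and radius. -/
noncomputable def arcKernel (c δ : ℝ) (z : ℂ) : ℂ :=
  δ / (1 + δ - z * Complex.exp (-c * Complex.I))

theorem norm_mul_exp_neg_mul_I (z : ℂ) (c : ℝ) : ‖z * Complex.exp (-c * Complex.I)‖ = ‖z‖ := by
  rw [norm_mul, ← Complex.ofReal_neg, Complex.norm_exp_ofReal_mul_I, mul_one]

theorem le_re_arcKernel_denom (c δ : ℝ) (z : ℂ) :
    δ + (1 - ‖z‖) ≤ (1 + δ - z * Complex.exp (-c * Complex.I)).re := by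
  have h := (Complex.re_le_norm (z * Complex.exp (-c * Complex.I))).trans_eq
    (norm_mul_exp_neg_mul_I z c)
  simp only [Complex.sub_re, Complex.add_re, Complex.one_re, Complex.ofReal_re]
  linarith

theorem arcKernel_denom_ne_zero {c δ : ℝ} (hδ : 0 < δ) {z : ℂ} (hz : ‖z‖ < 1) :
    (1 + δ - z * Complex.exp (-c * Complex.I)) ≠ 0 := by
  intro h
  have := le_re_arcKernel_denom c δ z
  rw [h, Complex.zero_re] at this
  linarith

theorem re_arcKernel (c δ : ℝ) (z : ℂ) :
    (arcKernel c δ z).re = δ * (1 + δ - z * Complex.exp (-c * Complex.I)).re /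
      ‖1 + δ - z * Complex.exp (-c * Complex.I)‖ ^ 2 := by
  rw [arcKernel, div_eq_mul_inv, Complex.re_ofReal_mul, Complex.inv_re, Complex.normSq_eq_norm_sq,
    mul_div_assoc]

theorem re_arcKernel_nonneg {c δ : ℝ} (hδ : 0 < δ) {z : ℂ} (hz : ‖z‖ < 1) :
    0 ≤ (arcKernel c δ z).re := by
  rw [re_arcKernel]
  have := le_re_arcKernel_denom c δ z
  exact div_nonneg (mul_nonneg hδ.le (by linarith)) (sq_nonneg _)

theorem norm_arcKernel_le {c δ : ℝ} (hδ : 0 < δ) {z : ℂ} {ρ : ℝ} (hρ : ρ < 1) (hz : ‖z‖ ≤ ρ) :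
    ‖arcKernel c δ z‖ ≤ δ * (1 - ρ)⁻¹ := by
  rw [arcKernel, norm_div, Complex.norm_real, Real.norm_of_nonneg hδ.le, div_eq_mul_inv]
  have h := (le_re_arcKernel_denom c δ z).trans (Complex.re_le_norm _)
  gcongr
  linarith

theorem differentiableOn_arcKernel {c δ : ℝ} (hδ : 0 < δ) :
    DifferentiableOn ℂ (arcKernel c δ) (Metric.ball 0 1) := by
  intro z hz
  have hz := arcKernel_denom_ne_zero (c := c) hδ (mem_ball_zero_iff.1 hz)
  unfold arcKernel
  exact DifferentiableAt.differentiableWithinAt (by fun_prop (disch := assumption))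

/-- The denominator has real part at least `δ` and modulus at most `3 * δ`, whence the bound `δ * δ
/ (3 * δ) ^ 2`. -/
theorem re_arcKernel_ge {c δ θ r : ℝ} (hδ : 0 < δ) (hθ : |θ - c| ≤ δ) (hr : 1 - δ ≤ r)
    (hr0 : 0 ≤ r) (hr1 : r < 1) :
    1 / 9 ≤ (arcKernel c δ (r * Complex.exp (θ * Complex.I))).re := by
  set z : ℂ := r * Complex.exp (θ * Complex.I) with hz
  have hnz : ‖z‖ = r := by
    rw [hz, norm_mul, Complex.norm_exp_ofReal_mul_I, Complex.norm_real, Real.norm_of_nonneg hr0,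
      mul_one]
  have hre := le_re_arcKernel_denom c δ z
  have hpos : 0 < ‖1 + δ - z * Complex.exp (-c * Complex.I)‖ :=
    norm_pos_iff.2 (arcKernel_denom_ne_zero hδ (hnz ▸ hr1))
  have hnorm : ‖1 + δ - z * Complex.exp (-c * Complex.I)‖ ≤ 3 * δ := by
    have h : 1 + δ - z * Complex.exp (-c * Complex.I) = (δ : ℂ) + ((1 - r : ℝ) : ℂ) -
        r * (Complex.exp ((θ - c : ℝ) * Complex.I) - Complex.exp ((0 : ℝ) * Complex.I)) := by
      rw [hz, mul_assoc, ← Complex.exp_add]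
      push_cast
      rw [← add_mul, ← sub_eq_add_neg]
      simp
      ring
    rw [h]
    refine (norm_sub_le _ _).trans ?_
    have h1 := norm_exp_mul_I_sub_le (θ - c) 0
    have h2 := norm_add_le (δ : ℂ) ((1 - r : ℝ) : ℂ)
    rw [Complex.norm_real, Complex.norm_real, Real.norm_of_nonneg hδ.le,
      Real.norm_of_nonneg (by linarith)] at h2
    rw [norm_mul, Complex.norm_real, Real.norm_of_nonneg hr0]
    rw [sub_zero] at h1
    nlinarith [mul_le_mul hr1.le (h1.trans hθ) (norm_nonneg _) zero_le_one]
  rw [re_arcKernel, div_le_div_iff₀ (by norm_num) (by positivity)]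
  have hδre : δ ≤ (1 + δ - z * Complex.exp (-c * Complex.I)).re := by linarith
  nlinarith [mul_le_mul_of_nonneg_left hδre hδ.le]

/-- For a null set of angles there is a holomorphic function of positive real part on the disc
whose real part tends to infinity along the radii in the directions of the set. -/
theorem exists_re_tendsto_atTop {S : Set ℝ} (hS : volume S = 0) :
    ∃ g : ℂ → ℂ, DifferentiableOn ℂ g (Metric.ball 0 1) ∧
      (∀ z ∈ Metric.ball (0 : ℂ) 1, 0 < (g z).re) ∧
      ∀ θ ∈ S, Tendsto (fun r : ℝ => (g (r * Complex.exp (θ * Complex.I))).re) (𝓝[<] 1) atTop := by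
  obtain ⟨ι, c, δ, hδ, hsum, hinf⟩ := exists_summable_infinite_cover hS
  have hsummable {z : ℂ} (hz : ‖z‖ < 1) : Summable fun i => arcKernel (c i) (δ i) z :=
    .of_norm_bounded (hsum.mul_right _) fun i => norm_arcKernel_le (hδ i) hz le_rfl
  -- The summand 1 makes the real part strictly positive.
  refine ⟨fun z => 1 + ∑' i, arcKernel (c i) (δ i) z, ?_, fun z hz => ?_, fun θ hθ => ?_⟩
  · refine (differentiableOn_const 1).add fun z hz => ?_
    obtain ⟨ρ, hzρ, hρ⟩ := exists_between (mem_ball_zero_iff.1 hz)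
    have h := Complex.differentiableOn_tsum_of_summable_norm (hsum.mul_right (1 - ρ)⁻¹)
      (fun i => (differentiableOn_arcKernel (c := c i) (hδ i)).mono (Metric.ball_subset_ball hρ.le))
      Metric.isOpen_ball
      (fun i w hw => norm_arcKernel_le (hδ i) hρ (mem_ball_zero_iff.1 hw).le)
    exact (h.differentiableAt
      (Metric.isOpen_ball.mem_nhds (mem_ball_zero_iff.2 hzρ))).differentiableWithinAt
  · have hz := mem_ball_zero_iff.1 hz
    rw [Complex.add_re, Complex.re_tsum (hsummable hz), Complex.one_re]
    linarith [tsum_nonneg (L := .unconditional ι) fun i => re_arcKernel_nonneg (c := c i) (hδ i) hz]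
  · refine tendsto_atTop.2 fun M => ?_
    -- Near the circle, `n` of the intervals around `θ` contribute at least `1 / 9` each.
    obtain ⟨n, hn⟩ := exists_nat_ge (9 * M)
    obtain ⟨s, hs, hcard⟩ := (hinf θ hθ).exists_subset_card_eq n
    have hev : ∀ᶠ r : ℝ in 𝓝[<] 1, ∀ i ∈ s, 1 - δ i ≤ r := by
      rw [Filter.eventually_all_finset]
      intro i _
      exact eventually_nhdsWithin_of_eventually_nhds (eventually_ge_nhds (by linarith [hδ i]))
    filter_upwards [hev, Ioo_mem_nhdsLT (zero_lt_one (α := ℝ))] with r hr h01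
    have hz : ‖(r : ℂ) * Complex.exp (θ * Complex.I)‖ < 1 := by
      rw [norm_mul, Complex.norm_exp_ofReal_mul_I, Complex.norm_real, Real.norm_of_nonneg h01.1.le,
        mul_one]
      exact h01.2
    rw [Complex.add_re, Complex.re_tsum (hsummable hz), Complex.one_re]
    have h1 := (Complex.reCLM.summable (hsummable hz)).sum_le_tsum s fun i _ =>
      re_arcKernel_nonneg (c := c i) (hδ i) hz
    have h2 := s.card_nsmul_le_sum
      (fun i => (arcKernel (c i) (δ i) (r * Complex.exp (θ * Complex.I))).re) (1 / 9)
      fun i hi => re_arcKernel_ge (hδ i) (hs hi) (hr i hi) h01.1.le h01.2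
    rw [hcard, nsmul_eq_mul] at h2
    change _ ≤ ∑' i, (arcKernel (c i) (δ i) _).re at h1
    linarith

/-! ### A bounded function without radial limits -/

theorem norm_ofReal_mul_circle_lt_one {r : ℝ} (hr : r ∈ Set.Ioo (0 : ℝ) 1) (w : Circle) :
    ‖(r : ℂ) * w‖ < 1 := by
  rw [norm_mul, Circle.norm_coe, mul_one, Complex.norm_real, Real.norm_of_nonneg hr.1.le]
  exact hr.2

theorem frequently_eq_of_tendsto_atTop {u : ℝ → ℝ} (hu : ContinuousOn u (Set.Ioo 0 1))
    (h : Tendsto u (𝓝[<] 1) atTop) {y : ℕ → ℝ} (hy : Tendsto y atTop atTop) :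
    ∃ᶠ r in 𝓝[<] (1 : ℝ), ∃ n, u r = y n := by
  have hIoo : Set.Ioo (0 : ℝ) 1 ∈ 𝓝[<] 1 := Ioo_mem_nhdsLT zero_lt_one
  refine fun hev => ?_
  obtain ⟨r₀, hr₀, hr₀'⟩ := (mem_nhdsLT_iff_exists_Ioo_subset' (zero_lt_one (α := ℝ))).1
    (inter_mem hev hIoo)
  obtain ⟨r₁, hr₁⟩ := exists_between (Set.mem_Iio.1 hr₀)
  obtain ⟨n, hn⟩ := (hy.eventually_ge_atTop (u r₁)).exists
  obtain ⟨r₂, hr₂, hr₂'⟩ := ((h.eventually_ge_atTop (y n)).and (Ioo_mem_nhdsLT hr₀)).exists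
  obtain ⟨x, hx, hxy⟩ := isPreconnected_Ioo.intermediate_value hr₁ hr₂'
    (hu.mono fun x hx => (hr₀' hx).2) ⟨hn, hr₂⟩
  exact (hr₀' hx).1 ⟨n, hxy⟩

/-- If `g` runs in the right half plane and its real part tends to infinity, then `g ^ i` spirals
without converging. -/
theorem not_tendsto_exp_I_mul_log {g : ℝ → ℂ} (hg : ContinuousOn g (Set.Ioo 0 1))
    (hpos : ∀ r ∈ Set.Ioo (0 : ℝ) 1, 0 < (g r).re)
    (hlim : Tendsto (fun r => (g r).re) (𝓝[<] 1) atTop) (l : ℂ) :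
    ¬ Tendsto (fun r => Complex.exp (Complex.I * Complex.log (g r))) (𝓝[<] 1) (𝓝 l) := by
  intro hl
  have hre (z : ℂ) : (Complex.exp (Complex.I * Complex.log z)).re =
      Real.exp (-z.arg) * Real.cos (Real.log ‖z‖) := by
    rw [Complex.exp_re]
    simp [Complex.log_re, Complex.log_im]
  have harg (z : ℂ) (hz : 0 < z.re) : Real.exp (-(Real.pi / 2)) ≤ Real.exp (-z.arg) :=
    Real.exp_le_exp.2 (neg_le_neg (abs_le.1 (Complex.abs_arg_le_pi_div_two_iff.2 hz.le)).2)
  have hlog : Tendsto (fun r => Real.log ‖g r‖) (𝓝[<] 1) atTop :=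
    Real.tendsto_log_atTop.comp (tendsto_atTop_mono (fun r => Complex.re_le_norm _) hlim)
  have hcont : ContinuousOn (fun r => Real.log ‖g r‖) (Set.Ioo 0 1) :=
    hg.norm.log fun r hr => (norm_pos_iff.2 fun h => by simpa [h] using hpos r hr).ne'
  have hseq (a : ℝ) : Tendsto (fun n : ℕ => a + n * (2 * Real.pi)) atTop atTop :=
    tendsto_atTop_add_const_left _ _
      (tendsto_natCast_atTop_atTop.atTop_mul_const Real.two_pi_pos)
  have hIoo : Set.Ioo (0 : ℝ) 1 ∈ 𝓝[<] 1 := Ioo_mem_nhdsLT zero_lt_one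
  have hlre := (Complex.continuous_re.tendsto l).comp hl
  have h0 := Real.exp_pos (-(Real.pi / 2))
  -- `log |g|` meets `2πℤ` and `π + 2πℤ` arbitrarily close to the endpoint; there the cosine is `1`
  -- and `-1`, which forces incompatible bounds on `l.re`.
  have h1 : Real.exp (-(Real.pi / 2)) ≤ l.re := by
    refine isClosed_Ici.mem_of_frequently_of_tendsto ?_ hlre
    refine ((frequently_eq_of_tendsto_atTop hcont hlog
      (hseq 0)).and_eventually hIoo).mono ?_
    rintro r ⟨⟨n, hn⟩, hr⟩
    simp only [Function.comp_apply, Set.mem_Ici]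
    rw [hre, hn, Real.cos_add_nat_mul_two_pi, Real.cos_zero, mul_one]
    exact harg _ (hpos r hr)
  have h2 : l.re ≤ -Real.exp (-(Real.pi / 2)) := by
    refine isClosed_Iic.mem_of_frequently_of_tendsto ?_ hlre
    refine ((frequently_eq_of_tendsto_atTop hcont hlog
      (hseq Real.pi)).and_eventually hIoo).mono ?_
    rintro r ⟨⟨n, hn⟩, hr⟩
    simp only [Function.comp_apply, Set.mem_Iic]
    rw [hre, hn, Real.cos_add_nat_mul_two_pi, Real.cos_pi, mul_neg_one]
    exact neg_le_neg (harg _ (hpos r hr))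
  linarith

theorem continuousOn_discExtend_radius {f : 𝔻 → ℂ} (hf : IsHolomorphicOnDisc f) (w : Circle) :
    ContinuousOn (fun r : ℝ => discExtend f (r * w)) (Set.Ioo 0 1) :=
  hf.continuousOn.comp (by fun_prop) fun _ hr =>
    mem_ball_zero_iff.2 (norm_ofReal_mul_circle_lt_one hr w)

/-- Lusin's theorem: for a null set of directions there is a bounded holomorphic function on the
disc without radial limits in these directions. -/
theorem exists_not_hasRadialLimitAt {S : Set ℝ} (hS : volume S = 0) :
    ∃ F : HInfty, ∀ θ ∈ S, ¬ HasRadialLimitAt (F : 𝔻 → ℂ) (Circle.exp θ) := by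
  obtain ⟨g, hg, hpos, hlim⟩ := exists_re_tendsto_atTop hS
  have hmem (z : 𝔻) : (z : ℂ) ∈ Metric.ball (0 : ℂ) 1 := mem_ball_zero_iff.2 z.norm_lt_one
  refine ⟨⟨fun z => Complex.exp (Complex.I * Complex.log (g z)), ?_, Real.exp (Real.pi / 2),
    fun z => ?_⟩, ?_⟩
  · refine isHolomorphicOnDisc_of_eq (F := fun z => Complex.exp (Complex.I * Complex.log (g z))) ?_
      fun _ => rfl
    exact ((hg.clog fun z hz => Or.inl (hpos z hz)).const_mul _).cexp
  · rw [Complex.norm_exp, Real.exp_le_exp]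
    have := (abs_le.1 (Complex.abs_arg_le_pi_div_two_iff.2 (hpos z (hmem z)).le)).1
    simp only [Complex.mul_re, Complex.I_re, Complex.I_im, Complex.log_im, zero_mul, one_mul,
      zero_sub]
    linarith
  · rintro θ hθ ⟨l, hl⟩
    have hball (r : ℝ) (hr : r ∈ Set.Ioo (0 : ℝ) 1) :
        (r : ℂ) * Complex.exp (θ * Complex.I) ∈ Metric.ball (0 : ℂ) 1 := by
      simpa using norm_ofReal_mul_circle_lt_one hr (Circle.exp θ)
    refine not_tendsto_exp_I_mul_log (hg.continuousOn.comp (by fun_prop) hball)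
      (fun r hr => hpos _ (hball r hr)) (hlim θ hθ) l (hl.congr' ?_)
    filter_upwards [Ioo_mem_nhdsLT (zero_lt_one (α := ℝ))] with r hr
    rw [discExtend_of_norm_lt _ (norm_ofReal_mul_circle_lt_one hr _)]
    simp

/-! ### Entire functions along bounded paths -/

/-- If `φ` is entire and not constant and `u` is a bounded path, then `u` converges as soon as
`φ ∘ u` does. -/
theorem exists_tendsto_of_tendsto_comp {φ : ℂ → ℂ} (hφ : Differentiable ℂ φ)
    (hne : ∀ K, ∃ z, φ z ≠ K) {u : ℝ → ℂ} (hu : ContinuousOn u (Set.Ioo 0 1)) {C : ℝ}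
    (hC : ∀ r ∈ Set.Ioo (0 : ℝ) 1, ‖u r‖ ≤ C) {l : ℂ}
    (hl : Tendsto (fun r => φ (u r)) (𝓝[<] 1) (𝓝 l)) :
    ∃ a, Tendsto u (𝓝[<] 1) (𝓝 a) := by
  have hIoo : Set.Ioo (0 : ℝ) 1 ∈ 𝓝[<] 1 := Ioo_mem_nhdsLT zero_lt_one
  obtain ⟨a, -, ha⟩ := (isCompact_closedBall (0 : ℂ) C).exists_mapClusterPt
    (f := 𝓝[<] (1 : ℝ)) (u := u) (le_principal_iff.2 <| mem_map.2 <| by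
      filter_upwards [hIoo] with r hr
      simpa using hC r hr)
  have hana : AnalyticOnNhd ℂ φ Set.univ := fun z _ => hφ.analyticAt z
  have hiso : ∀ᶠ z in 𝓝[≠] a, φ z ≠ l := by
    refine ((hana a trivial).eventually_eq_or_eventually_ne analyticAt_const).resolve_left
      fun h => ?_
    obtain ⟨z, hz⟩ := hne l
    exact hz (congrFun (hana.eq_of_eventuallyEq (fun _ _ => analyticAt_const) h) z)
  obtain ⟨ε, hε, hball⟩ := Metric.mem_nhdsWithin_iff.1 hiso
  refine ⟨a, Metric.tendsto_nhds.2 fun η hη => ?_⟩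
  set ρ := min (ε / 2) η with hρ
  have hρ0 : 0 < ρ := lt_min (half_pos hε) hη
  have hρε : ρ < ε := (min_le_left _ _).trans_lt (half_lt_self hε)
  -- `φ` omits `l` on this small sphere, whose compact image therefore keeps away from `l`. A path
  -- that returns to the ball but cannot cross the sphere stays inside.
  have hoff : ∀ᶠ r in 𝓝[<] (1 : ℝ), u r ∉ Metric.sphere a ρ := by
    have hcl : IsClosed (φ '' Metric.sphere a ρ) :=
      ((isCompact_sphere a ρ).image hφ.continuous).isClosed
    have hmem : (φ '' Metric.sphere a ρ)ᶜ ∈ 𝓝 l := by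
      refine hcl.isOpen_compl.mem_nhds ?_
      rintro ⟨z, hz, hzl⟩
      rw [Metric.mem_sphere] at hz
      refine hball ⟨Metric.mem_ball.2 (hz.trans_lt hρε), ?_⟩ hzl
      rintro rfl
      simp at hz
      linarith
    filter_upwards [hl hmem] with r hr h
    exact hr ⟨_, h, rfl⟩
  obtain ⟨r₀, hr₀, hr₀'⟩ := (mem_nhdsLT_iff_exists_Ioo_subset' (zero_lt_one (α := ℝ))).1
    (inter_mem hoff hIoo)
  have hfreq := ha.frequently (Metric.ball_mem_nhds a hρ0)
  obtain ⟨r₁, hr₁, hr₁'⟩ := (hfreq.and_eventually (Ioo_mem_nhdsLT hr₀)).exists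
  filter_upwards [Ioo_mem_nhdsLT hr₀] with r hr
  refine lt_of_lt_of_le ?_ (min_le_right (ε / 2) η)
  by_contra! hge
  have hcont : ContinuousOn (fun r => dist (u r) a) (Set.Ioo r₀ 1) :=

    continuous_dist.comp_continuousOn ((hu.mono fun x hx => (hr₀' hx).2).prodMk continuousOn_const)
  obtain ⟨x, hx, hxρ⟩ := isPreconnected_Ioo.intermediate_value hr₁' hr hcont
    ⟨(Metric.mem_ball.1 hr₁).le, hge⟩
  exact (hr₀' hx).1 hxρ

/-! ### Algebraic independence of exponentials -/

/-- The exponential `z ↦ exp (a z)`, as a character of the additive group of `ℂ`. -/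
noncomputable def expChar (a : ℂ) : Multiplicative ℂ →* ℂ where
  toFun z := Complex.exp (a * z.toAdd)
  map_one' := by simp
  map_mul' x y := by simp [mul_add, Complex.exp_add]

/-- The derivative at 0 recovers `a`. -/
theorem expChar_injective : Function.Injective expChar := by
  intro a b h
  have hfun (z : ℂ) : Complex.exp (a * z) = Complex.exp (b * z) :=
    DFunLike.congr_fun h (Multiplicative.ofAdd z)
  have hd (c : ℂ) : HasDerivAt (fun z : ℂ => Complex.exp (c * z)) c 0 := by
    simpa using ((hasDerivAt_id (0 : ℂ)).const_mul c).cexp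
  have := hd a
  rw [funext hfun] at this
  exact this.unique (hd b)

theorem aeval_exp_eq_sum {ι : Type*} (v : ι → ℂ) (p : MvPolynomial ι ℂ) (z : ℂ) :
    MvPolynomial.aeval (fun i => Complex.exp (v i * z)) p =
      ∑ m ∈ p.support, p.coeff m * Complex.exp ((m.sum fun i n => n * v i) * z) := by
  rw [MvPolynomial.aeval_eq_eval, MvPolynomial.eval_eq]
  refine Finset.sum_congr rfl fun m _ => ?_
  rw [Finsupp.sum, Finset.sum_mul, Complex.exp_sum]
  simp [← Complex.exp_nat_mul, mul_assoc]

/-- The exponentials `z ↦ exp (v i z)` are algebraically independent if the numbers `v i` are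
linearly independent over `ℚ`. -/
theorem eq_C_of_aeval_exp_eq {ι : Type*} {v : ι → ℂ} (hv : LinearIndependent ℚ v)
    {p : MvPolynomial ι ℂ} {K : ℂ}
    (h : ∀ z, MvPolynomial.aeval (fun i => Complex.exp (v i * z)) p = K) :
    p = MvPolynomial.C K := by
  -- Distinct monomials have distinct frequencies, so Dedekind's independence of characters applies.
  have hinj : Function.Injective fun m : ι →₀ ℕ => m.sum fun i n => (n : ℂ) * v i := by
    intro m m' hmm
    have hN : LinearIndependent ℕ v := hv.restrict_scalars' ℕ
    refine hN ?_
    simpa [Finsupp.linearCombination_apply, nsmul_eq_mul] using hmm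
  rw [← sub_eq_zero]
  set q := p - MvPolynomial.C K with hq
  have hlin := (linearIndependent_monoidHom (Multiplicative ℂ) ℂ).comp _
    (expChar_injective.comp hinj)
  rw [linearIndependent_iff'] at hlin
  have hzero : ∑ m ∈ q.support, q.coeff m • (fun m : ι →₀ ℕ =>
      (expChar (m.sum fun i n => (n : ℂ) * v i) : Multiplicative ℂ → ℂ)) m = 0 := by
    ext z
    have := aeval_exp_eq_sum v q z.toAdd
    rw [hq, map_sub, h, MvPolynomial.aeval_C, Algebra.algebraMap_self, RingHom.id_apply,
      sub_self, ← hq] at this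
    rw [Finset.sum_apply]
    exact this.symm
  ext m
  by_cases hm : m ∈ q.support
  · exact hlin _ _ hzero m hm
  · simpa using hm

/-! ### The generators in `H^∞` -/

/-- The function `exp (a F)`, for `F` bounded and holomorphic on the disc. -/
noncomputable def HInfty.expMul (F : HInfty) (a : ℂ) : HInfty :=
  ⟨fun z => Complex.exp (a * (F : 𝔻 → ℂ) z), by
    obtain ⟨F, hF, C, hC⟩ := F
    refine ⟨isHolomorphicOnDisc_of_eq (F := fun z => Complex.exp (a * discExtend F z))
      (hF.const_mul a).cexp fun z => by rw [discExtend_coe], Real.exp (‖a‖ * C), fun z => ?_⟩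
    rw [Complex.norm_exp, Real.exp_le_exp]
    refine (Complex.re_le_norm _).trans ?_
    rw [norm_mul]
    exact mul_le_mul_of_nonneg_left (hC z) (norm_nonneg a)⟩

theorem HInfty.aeval_expMul_apply (F : HInfty) {ι : Type*} (v : ι → ℂ) (p : MvPolynomial ι ℂ)
    (z : 𝔻) :
    (MvPolynomial.aeval (fun i => HInfty.expMul F (v i)) p : HInfty).1 z =
      MvPolynomial.aeval (fun i => Complex.exp (v i * F.1 z)) p := by
  exact MvPolynomial.comp_aeval_apply (fun i => HInfty.expMul F (v i))
    ((Pi.evalAlgHom ℂ (fun _ : 𝔻 => ℂ) z).comp HInfty.val) p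

/-- A polynomial in the exponentials `exp (v i F)` has a radial limit only where `F` has one,
unless the polynomial is constant. -/
theorem HInfty.eq_C_of_hasRadialLimitAt (F : HInfty) {ι : Type*} {v : ι → ℂ}
    (hv : LinearIndependent ℚ v) {w : Circle} (hw : ¬ HasRadialLimitAt (F : 𝔻 → ℂ) w)
    {p : MvPolynomial ι ℂ}
    (h : HasRadialLimitAt (MvPolynomial.aeval (fun i => HInfty.expMul F (v i)) p : HInfty).1 w) :
    ∃ K, p = MvPolynomial.C K := by
  by_contra! hp
  obtain ⟨l, hl⟩ := h
  obtain ⟨hF, C, hC⟩ := F.2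
  refine hw (exists_tendsto_of_tendsto_comp
    (φ := fun z => MvPolynomial.aeval (fun i => Complex.exp (v i * z)) p) ?_ (fun K => ?_)
    (continuousOn_discExtend_radius hF w) (C := C) (fun r hr => ?_) (l := l) (hl.congr' ?_))
  · simp_rw [aeval_exp_eq_sum]
    fun_prop
  · by_contra! h
    exact hp K (eq_C_of_aeval_exp_eq hv h)
  · rw [discExtend_of_norm_lt _ (norm_ofReal_mul_circle_lt_one hr w)]
    exact hC _
  · filter_upwards [Ioo_mem_nhdsLT (zero_lt_one (α := ℝ))] with r hr
    rw [discExtend_of_norm_lt _ (norm_ofReal_mul_circle_lt_one hr w),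
      discExtend_of_norm_lt _ (norm_ofReal_mul_circle_lt_one hr w), HInfty.aeval_expMul_apply F]

theorem hasRadialLimitAt_const (c : ℂ) (w : Circle) : HasRadialLimitAt (fun _ => c) w := by
  refine ⟨c, tendsto_const_nhds.congr' ?_⟩
  filter_upwards [Ioo_mem_nhdsLT (zero_lt_one (α := ℝ))] with r hr
  rw [discExtend_of_norm_lt _ (norm_ofReal_mul_circle_lt_one hr w)]

/-- The zero function has radial limits, so a relation must be a constant polynomial, hence zero. -/
theorem HInfty.algebraicIndependent_expMul (F : HInfty) {ι : Type*} {v : ι → ℂ}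
    (hv : LinearIndependent ℚ v) {w : Circle} (hw : ¬ HasRadialLimitAt (F : 𝔻 → ℂ) w) :
    AlgebraicIndependent ℂ fun i => HInfty.expMul F (v i) := by
  refine algebraicIndependent_iff.2 fun p hp => ?_
  obtain ⟨K, rfl⟩ := HInfty.eq_C_of_hasRadialLimitAt F hv hw (by
    rw [hp]
    exact hasRadialLimitAt_const 0 w)
  rw [MvPolynomial.aeval_C] at hp
  have : K = 0 := congrFun (congrArg Subtype.val hp) 0
  rw [this, map_zero]

/-! ### Non-unital generated subalgebras and their dimension -/

theorem exists_aeval_of_mem_nonUnital_adjoin {R A ι : Type*} [CommRing R] [CommRing A]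
    [Algebra R A] (x : ι → A) {f : A} (hf : f ∈ NonUnitalAlgebra.adjoin R (Set.range x)) :
    ∃ p : MvPolynomial ι R, p.constantCoeff = 0 ∧ MvPolynomial.aeval x p = f := by
  induction hf using NonUnitalAlgebra.adjoin_induction with
  | mem f hf =>
    obtain ⟨i, rfl⟩ := hf
    exact ⟨MvPolynomial.X i, by simp, by simp⟩
  | add f g _ _ hf hg =>
    obtain ⟨⟨p, hp, rfl⟩, ⟨q, hq, rfl⟩⟩ := And.intro hf hg
    exact ⟨p + q, by simp [hp, hq], by simp⟩
  | zero => exact ⟨0, by simp, by simp⟩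
  | mul f g _ _ hf hg =>
    obtain ⟨⟨p, hp, rfl⟩, ⟨q, hq, rfl⟩⟩ := And.intro hf hg
    exact ⟨p * q, by simp [hp], by simp⟩
  | smul r f _ hf =>
    obtain ⟨p, hp, rfl⟩ := hf
    exact ⟨r • p, by simp [MvPolynomial.smul_eq_C_mul, hp], by simp⟩

/-- There are only `𝔠` polynomials in `𝔠` variables over `ℂ`, and the generators are already
linearly independent. -/
theorem rank_nonUnital_adjoin_eq_continuum {A : Type} [CommRing A] [Algebra ℂ A] {G : Set A}
    (hG : #G = 𝔠) (hind : AlgebraicIndependent ℂ ((↑) : G → A)) :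
    Module.rank ℂ (NonUnitalAlgebra.adjoin ℂ G) = 𝔠 := by
  refine le_antisymm ((rank_le_card ℂ _).trans ?_) ?_
  · have hsurj : ∀ f : NonUnitalAlgebra.adjoin ℂ G,
        ∃ p : MvPolynomial G ℂ, MvPolynomial.aeval ((↑) : G → A) p = f := fun f => by
      obtain ⟨p, -, hp⟩ := exists_aeval_of_mem_nonUnital_adjoin (R := ℂ) ((↑) : G → A) (f := f)
        (by simp)
      exact ⟨p, hp⟩
    choose p hp using hsurj
    have hinj : Function.Injective p := fun f g h => Subtype.ext (by rw [← hp, ← hp, h])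
    refine (mk_le_of_injective hinj).trans (MvPolynomial.cardinalMk_le_max.trans ?_)
    simp [hG, Cardinal.mk_complex, aleph0_le_continuum]
  · rw [← hG]
    let e : G → NonUnitalAlgebra.adjoin ℂ G :=
      fun g => ⟨g, NonUnitalAlgebra.subset_adjoin ℂ g.2⟩
    let j : NonUnitalAlgebra.adjoin ℂ G →ₗ[ℂ] A :=
      { toFun := Subtype.val, map_add' := fun _ _ => rfl, map_smul' := fun _ _ => rfl }
    have hlin : LinearIndependent ℂ e := .of_comp j hind.linearIndependent
    exact hlin.cardinal_le_rank

/-! ### The theorem -/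

theorem mainTheorem1 (E : Set Circle) (hE : arcLength E = 0) :
    (∃ A : NonUnitalSubalgebra ℂ HInfty,
        Module.rank ℂ A = 𝔠 ∧
        ∀ f ∈ A, f ≠ 0 → ∀ w ∈ E, ¬ HasRadialLimitAt (f : 𝔻 → ℂ) w) ∧
      IsStronglyAlgebrable ℂ 𝔠 (lusinSet E) := by
  set S : Set ℝ := {θ | θ ∈ Set.Ico 0 (2 * Real.pi) ∧ Circle.exp θ ∈ E} with hS
  -- Adding the angle 0 gives `F` a direction without limit even if `E` is empty, as algebraic
  -- independence needs one.
  have hS0 : volume (insert 0 S) = 0 := by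
    rw [Set.insert_eq]
    exact measure_union_null Real.volume_singleton hE
  obtain ⟨F, hF⟩ := exists_not_hasRadialLimitAt hS0
  have hFE : ∀ w ∈ E, ¬ HasRadialLimitAt (F : 𝔻 → ℂ) w := by
    intro w hw
    obtain ⟨θ, hθ, rfl⟩ : ∃ θ ∈ Set.Ico 0 (2 * Real.pi), Circle.exp θ = w := by
      obtain ⟨θ, hθ, h⟩ := Circle.periodic_exp.exists_mem_Ico₀ Real.two_pi_pos (Complex.arg w)
      exact ⟨θ, hθ, h ▸ Circle.exp_arg w⟩
    exact hF θ (Or.inr ⟨hθ, hw⟩)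
  let b := Module.Basis.ofVectorSpace ℚ ℂ
  have hcard : #(Module.Basis.ofVectorSpaceIndex ℚ ℂ) = 𝔠 := by
    rw [b.mk_eq_rank'', Complex.rank_rat_complex]
  have hind := HInfty.algebraicIndependent_expMul F b.linearIndependent (hF 0 (Or.inl rfl))
  set G := Set.range fun i => HInfty.expMul F (b i)
  have hG : #G = 𝔠 := by rw [mk_range_eq _ hind.injective, hcard]
  have hlusin : ∀ f ∈ NonUnitalAlgebra.adjoin ℂ G, f ≠ 0 →
      ∀ w ∈ E, ¬ HasRadialLimitAt (f : 𝔻 → ℂ) w := by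
    intro f hf hf0 w hw hlim
    obtain ⟨p, hp, rfl⟩ := exists_aeval_of_mem_nonUnital_adjoin _ hf
    obtain ⟨K, rfl⟩ := HInfty.eq_C_of_hasRadialLimitAt F b.linearIndependent (hFE w hw) hlim
    rw [MvPolynomial.constantCoeff_C] at hp
    exact hf0 (by rw [hp, map_zero, map_zero])
  refine ⟨⟨_, rank_nonUnital_adjoin_eq_continuum hG hind.coe_range, hlusin⟩,
    G, hG, hind.coe_range, fun f hf => ?_⟩
  by_cases hf0 : f = 0
  · exact Or.inr hf0
  · exact Or.inl (hlusin f hf hf0)
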